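/- \textbf{Theorem (Stackelberg signaling thresholds).} Let $m\sim\mathcal N(0,\sigma_m^2)$ and $w\sim\mathcal N(0,\sigma_w^2)$ be independent real random variables with $\sigma_m,\sigma_w>0$, and let $a,b\in\mathbb R$ and $\rho>0$. An encoder chooses a Borel function $\gamma^e:\mathbb R\to\mathbb R$ and sends $x=\gamma^e(m)$; a decoder observes $y=x+w$, chooses a Borel function $\gamma^d:\mathbb R\to\mathbb R$, and acts by $u=\gamma^d(y)$. Their expected costs, with values in $[0,\infty]$, are $$J^d(\gamma^e,\gamma^d)=\mathbb E[(m-u)^2],\qquad J^e(\gamma^e,\gamma^d)=\mathbb E[(am-b-u)^2+\rho x^2].$$ A best response to $\gamma^e$ is a Borel minimizer $\gamma^d$ of $J^d(\gamma^e,\cdot)$. A Stackelberg equilibrium (SE) is a pair $(\gamma^e,\gamma^d)$ such that $\gamma^d$ is a best response to $\gamma^e$ and $J^e(\gamma^e,\gamma^d)\le J^e(\tilde\gamma^e,\tilde\gamma^d)$ for every Borel $\tilde\gamma^e$ and every best response $\tilde\gamma^d$ to $\tilde\gamma^e$. An SE is \emph{informative} if $m$ and $x$ are not independent, and \emph{non-informative}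 if $u=\mathbb E[m]$ almost surely. The power of an SE is $\mathbb E[x^2]$. Uniqueness of an SE means that $x$ and $u$ are unique up to almost sure equality. \begin{enumerate} \item If $a\le\tfrac12$, an SE exists and is unique; it is non-informative, is not informative ($m$ and $x$ are independent), and has power $0$. \item If $a>\tfrac12$, an informative SE exists if and only if $$\rho<\frac{\sigma_m^2}{\sigma_w^2}(2a-1).$$ If this inequality holds, then $$P^*=\sigma_w\sqrt{\frac{(2a-1)\sigma_m^2}{\rho}}-\sigma_w^2>0,$$ every SE has power $P^*$, and for every $\alpha\in\mathbb R$ with $\alpha^2=P^*/\sigma_m^2$ the linear encoder $\gamma^e(t)=\alpha t$, together with some decoder policy, is an informative SE. If the inequality fails, an SE exists and is unique; it is non-informative, is not informative, and has power $0$. \end{enumerate} -/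

import Mathlib

open MeasureTheory ProbabilityTheory
open scoped ENNReal NNReal

noncomputable section

namespace GaussianSignaling

/-- The channel output `y = γe(m) + w`. -/
def received {Ω : Type*} (m w : Ω → ℝ) (γe : ℝ → ℝ) (ω : Ω) : ℝ := γe (m ω) + w ω

/-- The decoder's action `u = γd(y)`. -/
def action {Ω : Type*} (m w : Ω → ℝ) (γe γd : ℝ → ℝ) (ω : Ω) : ℝ := γd (received m w γe ω)

/-- The decoder's expected cost `E[(m - u)²]`, with values in `[0, ∞]`. -/
def decoderCost {Ω : Type*} [MeasurableSpace Ω] (μ : Measure Ω) (m w : Ω → ℝ)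
    (γe γd : ℝ → ℝ) : ℝ≥0∞ :=
  ∫⁻ ω, ENNReal.ofReal ((m ω - action m w γe γd ω) ^ 2) ∂μ

/-- The encoder's expected cost `E[(a m - b - u)² + ρ x²]` with `x = γe(m)`, with values in
`[0, ∞]`. The integrand is nonnegative for `ρ ≥ 0`. -/
def encoderCost {Ω : Type*} [MeasurableSpace Ω] (μ : Measure Ω) (m w : Ω → ℝ)
    (a b ρ : ℝ) (γe γd : ℝ → ℝ) : ℝ≥0∞ :=
  ∫⁻ ω, ENNReal.ofReal ((a * m ω - b - action m w γe γd ω) ^ 2 + ρ * (γe (m ω)) ^ 2) ∂μ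

/-- The average transmission power `E[x²]`, with values in `[0, ∞]`. -/
def power {Ω : Type*} [MeasurableSpace Ω] (μ : Measure Ω) (m : Ω → ℝ) (γe : ℝ → ℝ) : ℝ≥0∞ :=
  ∫⁻ ω, ENNReal.ofReal ((γe (m ω)) ^ 2) ∂μ

/-- `γd` minimizes the decoder's cost against `γe` among all Borel decoder policies. -/
structure IsBestResponse {Ω : Type*} [MeasurableSpace Ω] (μ : Measure Ω) (m w : Ω → ℝ)
    (γe γd : ℝ → ℝ) : Prop where
  measurable : Measurable γd
  le : ∀ γd' : ℝ → ℝ, Measurable γd' → decoderCost μ m w γe γd ≤ decoderCost μ m w γe γd'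

/-- Stackelberg equilibrium with the encoder as the leader: the decoder best responds to `γe`, and
no other Borel encoder policy, followed by a best response of the decoder, gives the encoder a
smaller cost. -/
structure IsStackelbergEquilibrium {Ω : Type*} [MeasurableSpace Ω] (μ : Measure Ω) (m w : Ω → ℝ)
    (a b ρ : ℝ) (γe γd : ℝ → ℝ) : Prop where
  measurable : Measurable γe
  bestResponse : IsBestResponse μ m w γe γd
  le : ∀ γe' γd' : ℝ → ℝ, Measurable γe' → IsBestResponse μ m w γe' γd' →
    encoderCost μ m w a b ρ γe γd ≤ encoderCost μ m w a b ρ γe' γd'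

/-- The source `m` and the message `x = γe(m)` are not independent. -/
def IsInformative {Ω : Type*} [MeasurableSpace Ω] (μ : Measure Ω) (m : Ω → ℝ)
    (γe : ℝ → ℝ) : Prop :=
  ¬ IndepFun m (fun ω => γe (m ω)) μ

/-- The decoder's action is almost surely the prior mean: `u = E[m]`. -/
def IsNonInformative {Ω : Type*} [MeasurableSpace Ω] (μ : Measure Ω) (m w : Ω → ℝ)
    (γe γd : ℝ → ℝ) : Prop :=
  ∀ᵐ ω ∂μ, action m w γe γd ω = ∫ ω', m ω' ∂μ

/-- There is a Stackelberg equilibrium, and it is unique up to almost sure equality of the message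
and of the decoder's action. -/
def HasUniqueEquilibrium {Ω : Type*} [MeasurableSpace Ω] (μ : Measure Ω) (m w : Ω → ℝ)
    (a b ρ : ℝ) : Prop :=
  (∃ γe γd : ℝ → ℝ, IsStackelbergEquilibrium μ m w a b ρ γe γd) ∧
  ∀ γe γd γe' γd' : ℝ → ℝ, IsStackelbergEquilibrium μ m w a b ρ γe γd →
    IsStackelbergEquilibrium μ m w a b ρ γe' γd' →
    (∀ᵐ ω ∂μ, γe (m ω) = γe' (m ω)) ∧
    (∀ᵐ ω ∂μ, action m w γe γd ω = action m w γe' γd' ω)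

/-- The Stackelberg equilibrium exists, is almost surely unique, is non-informative (the action is
the prior mean, and the message is independent of the source), and uses no power. -/
def UniqueEquilibriumIsNonInformative {Ω : Type*} [MeasurableSpace Ω] (μ : Measure Ω)
    (m w : Ω → ℝ) (a b ρ : ℝ) : Prop :=
  HasUniqueEquilibrium μ m w a b ρ ∧
  ∀ γe γd : ℝ → ℝ, IsStackelbergEquilibrium μ m w a b ρ γe γd →
    IsNonInformative μ m w γe γd ∧ ¬ IsInformative μ m γe ∧ power μ m γe = 0

/-- The power `σ_w √((2a - 1) σ_m² / ρ) - σ_w²`. -/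
def optimalPower (a ρ σm σw : ℝ) : ℝ :=
  σw * Real.sqrt ((2 * a - 1) * σm ^ 2 / ρ) - σw ^ 2

end GaussianSignaling

end

/-! Against a best response the error `m - u` is orthogonal to functions of `y`, so E[u] = E[m] = 0
and E[mu] = E[u²]. With U = E[u²] and P = E[x²] the encoder's cost becomes a²σ_m² + b² + (1 - 2a)U +
ρP, and the game reduces to choosing the pair (U, P).

The constraint on this pair is the Gaussian rate-distortion and capacity bound σ_m²σ_w² ≤ E[(m -
u)²](P + σ_w²) (`mul_le_distortion_mul`), which for a best response says U ≤ σ_m²P/(P + σ_w²). It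
follows directly from log T ≤ T - 1, where T is a ratio of two densities for source and noise and so
has mean 1. Linear encoders with the linear least-squares decoder attain equality.

What remains is a one-variable problem (`IsOptimalPower`). If a ≤ 1/2, both terms favour U = P = 0.
If a > 1/2, with Q = P + σ_w² the cost is, up to a constant, ρQ + (2a - 1)σ_m²σ_w²/Q, minimal at Q²
= (2a - 1)σ_m²σ_w²/ρ; the threshold on ρ expresses that this Q exceeds σ_w². Since the optimal power
is unique and linear policies realize it, every equilibrium has this power. -/

namespace GaussianSignaling

/-! ### The density ratio: total mass and logarithm -/

/-- The ratio of the joint density `N(u(y), d)(s) · N(0, q)(y)` to the density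
`N(0, vm)(s) · N(0, vw)(n)` of source and noise, where `y = γe s + n` and `u = γd`. -/
noncomputable def densityRatio (vm vw d q : ℝ≥0) (γe γd : ℝ → ℝ) (p : ℝ × ℝ) : ℝ :=
  gaussianPDFReal (γd (γe p.1 + p.2)) d p.1 * gaussianPDFReal 0 q (γe p.1 + p.2) /
    (gaussianPDFReal 0 vm p.1 * gaussianPDFReal 0 vw p.2)

lemma measurable_densityRatio {vm vw d q : ℝ≥0} {γe γd : ℝ → ℝ} (he : Measurable γe)
    (hd : Measurable γd) : Measurable (densityRatio vm vw d q γe γd) := by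
  unfold densityRatio
  have hy : Measurable fun p : ℝ × ℝ => γe p.1 + p.2 := by fun_prop
  have h1 : Measurable fun p : ℝ × ℝ => gaussianPDFReal (γd (γe p.1 + p.2)) d p.1 :=
    measurable_uncurry_gaussianPDFReal.comp
      ((hd.comp hy).prodMk (measurable_const.prodMk measurable_fst))
  have h2 := (measurable_gaussianPDFReal 0 q).comp hy
  have h3 := (measurable_gaussianPDFReal 0 vm).comp (measurable_fst : Measurable (Prod.fst : ℝ × ℝ → ℝ))
  have h4 := (measurable_gaussianPDFReal 0 vw).comp (measurable_snd : Measurable (Prod.snd : ℝ × ℝ → ℝ))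
  exact (h1.mul h2).div (h3.mul h4)

lemma densityRatio_pos {vm vw d q : ℝ≥0} (hvm : vm ≠ 0) (hvw : vw ≠ 0) (hd : d ≠ 0) (hq : q ≠ 0)
    (γe γd : ℝ → ℝ) (p : ℝ × ℝ) : 0 < densityRatio vm vw d q γe γd p :=
  div_pos (mul_pos (gaussianPDFReal_pos _ _ _ hd) (gaussianPDFReal_pos _ _ _ hq))
    (mul_pos (gaussianPDFReal_pos _ _ _ hvm) (gaussianPDFReal_pos _ _ _ hvw))

/-- On each fibre of fixed first coordinate the shear is a translation, which preserves Lebesgue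
measure. -/
lemma lintegral_prod_shear {F : ℝ × ℝ → ℝ≥0∞} (hF : Measurable F) {g : ℝ → ℝ}
    (hg : Measurable g) :
    ∫⁻ p : ℝ × ℝ, F (p.1, g p.1 + p.2) ∂(volume.prod volume) =
      ∫⁻ p : ℝ × ℝ, F p ∂(volume.prod volume) := by
  have hm : Measurable fun p : ℝ × ℝ => F (p.1, g p.1 + p.2) :=
    hF.comp (measurable_fst.prodMk ((hg.comp measurable_fst).add measurable_snd))
  rw [lintegral_prod _ hm.aemeasurable, lintegral_prod _ hF.aemeasurable]
  exact lintegral_congr fun s => lintegral_add_left_eq_self (fun y => F (s, y)) (g s)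

lemma density_mul_densityRatio {vm vw d q : ℝ≥0} (hvm : vm ≠ 0) (hvw : vw ≠ 0) (γe γd : ℝ → ℝ)
    (p : ℝ × ℝ) : gaussianPDF 0 vm p.1 * gaussianPDF 0 vw p.2 *
      ENNReal.ofReal (densityRatio vm vw d q γe γd p) =
      gaussianPDF (γd (γe p.1 + p.2)) d p.1 * gaussianPDF 0 q (γe p.1 + p.2) := by
  have h1 := gaussianPDFReal_pos 0 vm p.1 hvm
  have h2 := gaussianPDFReal_pos 0 vw p.2 hvw
  simp only [gaussianPDF]
  rw [← ENNReal.ofReal_mul h1.le, ← ENNReal.ofReal_mul (mul_pos h1 h2).le,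
    ← ENNReal.ofReal_mul (gaussianPDFReal_nonneg _ _ _), densityRatio,
    mul_div_cancel₀ _ (mul_pos h1 h2).ne']

/-- After the shear (s, n) ↦ (s, γe s + n) the integrand is a Gaussian density in s, with a mean
depending on y, times a Gaussian density in y. Integrating over s before y gives 1 whatever the
decoder is. -/
lemma lintegral_densityRatio {vm vw d q : ℝ≥0} (hvm : vm ≠ 0) (hvw : vw ≠ 0) (hd : d ≠ 0)
    (hq : q ≠ 0) {γe γd : ℝ → ℝ} (he : Measurable γe) (hγd : Measurable γd) :
    ∫⁻ p, ENNReal.ofReal (densityRatio vm vw d q γe γd p)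
      ∂((gaussianReal 0 vm).prod (gaussianReal 0 vw)) = 1 := by
  have hT := (measurable_densityRatio (vm := vm) (vw := vw) (d := d) (q := q) he hγd).ennreal_ofReal
  have hr : Measurable fun p : ℝ × ℝ => gaussianPDF (γd p.2) d p.1 :=
    measurable_uncurry_gaussianPDF.comp
      ((hγd.comp measurable_snd).prodMk (measurable_const.prodMk measurable_fst))
  have hg1 : Measurable fun p : ℝ × ℝ => gaussianPDF 0 vm p.1 :=
    (measurable_gaussianPDF 0 vm).comp measurable_fst
  have hg2 : Measurable fun p : ℝ × ℝ => gaussianPDF 0 vw p.2 :=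
    (measurable_gaussianPDF 0 vw).comp measurable_snd
  have hg3 : Measurable fun p : ℝ × ℝ => gaussianPDF 0 q p.2 :=
    (measurable_gaussianPDF 0 q).comp measurable_snd
  have hg12 : Measurable fun p : ℝ × ℝ => gaussianPDF 0 vm p.1 * gaussianPDF 0 vw p.2 :=
    hg1.mul hg2
  have hrq : Measurable fun p : ℝ × ℝ => gaussianPDF (γd p.2) d p.1 * gaussianPDF 0 q p.2 :=
    hr.mul hg3
  rw [gaussianReal_of_var_ne_zero _ hvm, gaussianReal_of_var_ne_zero _ hvw,
    prod_withDensity (measurable_gaussianPDF _ _) (measurable_gaussianPDF _ _),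
    lintegral_withDensity_eq_lintegral_mul _ hg12 hT]
  simp only [Pi.mul_apply]
  rw [lintegral_congr (density_mul_densityRatio hvm hvw γe γd)]
  refine (lintegral_prod_shear (F := fun p => gaussianPDF (γd p.2) d p.1 * gaussianPDF 0 q p.2)
    hrq he).trans ?_
  rw [lintegral_prod_symm _ hrq.aemeasurable]
  simp_rw [lintegral_mul_const _ (measurable_gaussianPDF _ _), lintegral_gaussianPDF_eq_one _ hd,
    one_mul, lintegral_gaussianPDF_eq_one _ hq]

lemma log_gaussianPDFReal (c : ℝ) {v : ℝ≥0} (hv : v ≠ 0) (s : ℝ) :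
    Real.log (gaussianPDFReal c v s) =
      -(Real.log (2 * Real.pi) + Real.log v) / 2 - (s - c) ^ 2 / (2 * v) := by
  have hv' : (0 : ℝ) < v := NNReal.coe_pos.2 (pos_iff_ne_zero.2 hv)
  rw [gaussianPDFReal, Real.log_mul (by positivity) (Real.exp_ne_zero _), Real.log_exp,
    Real.log_inv, Real.log_sqrt (by positivity), Real.log_mul (by positivity) hv'.ne']
  ring

lemma log_densityRatio {vm vw d q : ℝ≥0} (hvm : vm ≠ 0) (hvw : vw ≠ 0) (hd : d ≠ 0) (hq : q ≠ 0)
    (γe γd : ℝ → ℝ) (p : ℝ × ℝ) : Real.log (densityRatio vm vw d q γe γd p) =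
      (Real.log vm + Real.log vw - Real.log d - Real.log q) / 2 -
        (2 * (d : ℝ))⁻¹ * (p.1 - γd (γe p.1 + p.2)) ^ 2 - (2 * (q : ℝ))⁻¹ * (γe p.1 + p.2) ^ 2 +
        (2 * (vm : ℝ))⁻¹ * p.1 ^ 2 + (2 * (vw : ℝ))⁻¹ * p.2 ^ 2 := by
  have h1 := (gaussianPDFReal_pos 0 vm p.1 hvm).ne'
  have h2 := (gaussianPDFReal_pos 0 vw p.2 hvw).ne'
  have h3 := (gaussianPDFReal_pos (γd (γe p.1 + p.2)) d p.1 hd).ne'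
  have h4 := (gaussianPDFReal_pos 0 q (γe p.1 + p.2) hq).ne'
  rw [densityRatio, Real.log_div (mul_ne_zero h3 h4) (mul_ne_zero h1 h2), Real.log_mul h3 h4,
    Real.log_mul h1 h2, log_gaussianPDFReal _ hvm, log_gaussianPDFReal _ hvw,
    log_gaussianPDFReal _ hd, log_gaussianPDFReal _ hq]
  ring

/-! ### Second moments and the distortion bound -/

section

variable {Ω : Type*} [MeasurableSpace Ω] {μ : Measure Ω}

lemma memLp_two_of_hasLaw_gaussianReal {X : Ω → ℝ} {v : ℝ≥0} (hX : HasLaw X (gaussianReal 0 v) μ) :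
    MemLp X 2 μ := by
  have h : MemLp id 2 (μ.map X) := by rw [hX.map_eq]; exact memLp_id_gaussianReal' 2 (by simp)
  exact h.comp_of_map hX.aemeasurable

lemma integral_of_hasLaw_gaussianReal {X : Ω → ℝ} {v : ℝ≥0} (hX : HasLaw X (gaussianReal 0 v) μ) :
    ∫ ω, X ω ∂μ = 0 := by
  rw [hX.integral_eq, integral_id_gaussianReal]

lemma integral_sq_of_hasLaw_gaussianReal {X : Ω → ℝ} {v : ℝ≥0}
    (hX : HasLaw X (gaussianReal 0 v) μ) : ∫ ω, X ω ^ 2 ∂μ = v := by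
  have h := hX.variance_eq
  rw [variance_id_gaussianReal, variance_of_integral_eq_zero hX.aemeasurable
    (integral_of_hasLaw_gaussianReal hX)] at h
  exact h

variable {m w : Ω → ℝ} {vm vw : ℝ≥0}

/-- Integrability of `f (m ω)` is not needed: the product formula for independent variables holds
with the convention that a non-integrable function has integral 0, and the factor E[w] vanishes. -/
lemma integral_comp_mul_noise (hm : AEMeasurable m μ) (hw : HasLaw w (gaussianReal 0 vw) μ)
    (hmw : IndepFun m w μ) {f : ℝ → ℝ} (hf : Measurable f) : ∫ ω, f (m ω) * w ω ∂μ = 0 := by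
  have hi : IndepFun (fun ω => f (m ω)) w μ := hmw.comp hf measurable_id
  rw [hi.integral_fun_mul_eq_mul_integral (hf.comp_aemeasurable hm).aestronglyMeasurable
    hw.aemeasurable.aestronglyMeasurable, integral_of_hasLaw_gaussianReal hw, mul_zero]

lemma integral_received_sq (hm : AEMeasurable m μ) (hw : HasLaw w (gaussianReal 0 vw) μ)
    (hmw : IndepFun m w μ) {γe : ℝ → ℝ} (he : Measurable γe)
    (hx : MemLp (fun ω => γe (m ω)) 2 μ) :
    ∫ ω, received m w γe ω ^ 2 ∂μ = ∫ ω, γe (m ω) ^ 2 ∂μ + vw := by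
  have hw2 := memLp_two_of_hasLaw_gaussianReal hw
  have hxw : Integrable (fun ω => γe (m ω) * w ω) μ := hx.integrable_mul hw2
  have e : ∀ ω, received m w γe ω ^ 2 = γe (m ω) ^ 2 + 2 * (γe (m ω) * w ω) + w ω ^ 2 := by
    intro ω; simp only [received]; ring
  have i : Integrable (fun ω => γe (m ω) ^ 2 + 2 * (γe (m ω) * w ω)) μ :=
    hx.integrable_sq.add (hxw.const_mul 2)
  simp_rw [e]
  rw [integral_add i hw2.integrable_sq,
    integral_add hx.integrable_sq (hxw.const_mul 2), integral_const_mul,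
    integral_comp_mul_noise hm hw hmw he, integral_sq_of_hasLaw_gaussianReal hw]
  ring

variable [IsProbabilityMeasure μ]

/-- The information-theoretic lower bound on the distortion, in terms of the power. -/
theorem mul_le_distortion_mul (hvm : vm ≠ 0) (hvw : vw ≠ 0)
    (hm : HasLaw m (gaussianReal 0 vm) μ) (hw : HasLaw w (gaussianReal 0 vw) μ)
    (hmw : IndepFun m w μ) {γe γd : ℝ → ℝ} (he : Measurable γe) (hγd : Measurable γd)
    (hx : MemLp (fun ω => γe (m ω)) 2 μ) (hu : MemLp (fun ω => m ω - action m w γe γd ω) 2 μ) :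
    (vm : ℝ) * vw ≤
      (∫ ω, (m ω - action m w γe γd ω) ^ 2 ∂μ) * (∫ ω, γe (m ω) ^ 2 ∂μ + vw) := by
  set D := ∫ ω, (m ω - action m w γe γd ω) ^ 2 ∂μ with hD
  set P := ∫ ω, γe (m ω) ^ 2 ∂μ with hP
  have hD0 : 0 ≤ D := integral_nonneg fun _ => sq_nonneg _
  have hP0 : 0 ≤ P := integral_nonneg fun _ => sq_nonneg _
  have hvm' : (0 : ℝ) < vm := NNReal.coe_pos.2 (pos_iff_ne_zero.2 hvm)
  have hvw' : (0 : ℝ) < vw := NNReal.coe_pos.2 (pos_iff_ne_zero.2 hvw)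
  have hQ : 0 < P + vw := by linarith
  -- Nothing excludes D = 0 yet, and a Gaussian of variance 0 has no density; hence the test
  -- variance is any d > D, and D is reached in the limit.
  suffices h : ∀ d : ℝ, D < d → (vm : ℝ) * vw / (P + vw) ≤ d by
    rw [← div_le_iff₀ hQ]; exact le_of_forall_gt_imp_ge_of_dense h
  intro d hd
  have hd0 : 0 < d := hD0.trans_lt hd
  lift d to ℝ≥0 using hd0.le
  -- The second test variance is that of the channel output, q = E[y²].
  obtain ⟨q, hq⟩ : ∃ q : ℝ≥0, (q : ℝ) = P + vw := ⟨⟨P + vw, hQ.le⟩, rfl⟩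
  have hq0 : q ≠ 0 := by rintro rfl; simp at hq; linarith
  have hdz : d ≠ 0 := by rintro rfl; simp at hd0
  have hlaw : HasLaw (fun ω => (m ω, w ω)) ((gaussianReal 0 vm).prod (gaussianReal 0 vw)) μ :=
    ⟨hm.aemeasurable.prodMk hw.aemeasurable, by
      rw [(indepFun_iff_map_prod_eq_prod_map_map hm.aemeasurable hw.aemeasurable).1 hmw,
        hm.map_eq, hw.map_eq]⟩
  have hTm := measurable_densityRatio (vm := vm) (vw := vw) (d := d) (q := q) he hγd
  have hT1 : ∫⁻ ω, ENNReal.ofReal (densityRatio vm vw d q γe γd (m ω, w ω)) ∂μ = 1 := by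
    rw [← lintegral_densityRatio hvm hvw hdz hq0 he hγd]
    exact hlaw.lintegral_comp (f := fun p => ENNReal.ofReal (densityRatio vm vw d q γe γd p))
      hTm.ennreal_ofReal.aemeasurable
  have hTnn : ∀ ω, 0 ≤ densityRatio vm vw d q γe γd (m ω, w ω) := fun ω =>
    (densityRatio_pos hvm hvw hdz hq0 γe γd _).le
  have hTae : AEStronglyMeasurable (fun ω => densityRatio vm vw d q γe γd (m ω, w ω)) μ :=
    (hTm.comp_aemeasurable hlaw.aemeasurable).aestronglyMeasurable
  have hTi : Integrable (fun ω => densityRatio vm vw d q γe γd (m ω, w ω)) μ := by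
    refine ⟨hTae, ?_⟩
    rw [hasFiniteIntegral_iff_ofReal (Filter.Eventually.of_forall hTnn), hT1]
    simp
  have hTint : ∫ ω, densityRatio vm vw d q γe γd (m ω, w ω) ∂μ = 1 := by
    rw [integral_eq_lintegral_of_nonneg_ae (Filter.Eventually.of_forall hTnn) hTae, hT1]
    simp
  have hm2 := memLp_two_of_hasLaw_gaussianReal hm
  have hw2 := memLp_two_of_hasLaw_gaussianReal hw
  have hy : MemLp (received m w γe) 2 μ := hx.add hw2
  have i1 := hu.integrable_sq.const_mul (2 * (d : ℝ))⁻¹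
  have i2 := hy.integrable_sq.const_mul (2 * (q : ℝ))⁻¹
  have i3 := hm2.integrable_sq.const_mul (2 * (vm : ℝ))⁻¹
  have i4 := hw2.integrable_sq.const_mul (2 * (vw : ℝ))⁻¹
  set c := (Real.log vm + Real.log vw - Real.log d - Real.log q) / 2 with hc
  have i0 : Integrable (fun _ : Ω => c) μ := integrable_const c
  have j1 : Integrable (fun ω => c - (2 * (d : ℝ))⁻¹ * (m ω - action m w γe γd ω) ^ 2) μ :=
    i0.sub i1
  have j2 : Integrable (fun ω => c - (2 * (d : ℝ))⁻¹ * (m ω - action m w γe γd ω) ^ 2 -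
      (2 * (q : ℝ))⁻¹ * received m w γe ω ^ 2) μ := j1.sub i2
  have j3 : Integrable (fun ω => c - (2 * (d : ℝ))⁻¹ * (m ω - action m w γe γd ω) ^ 2 -
      (2 * (q : ℝ))⁻¹ * received m w γe ω ^ 2 + (2 * (vm : ℝ))⁻¹ * m ω ^ 2) μ := j2.add i3
  -- Gibbs' inequality: integrating log T ≤ T - 1 bounds E[log T] by 0.
  have key : ∫ ω, (c - (2 * (d : ℝ))⁻¹ * (m ω - action m w γe γd ω) ^ 2 -
      (2 * (q : ℝ))⁻¹ * received m w γe ω ^ 2 + (2 * (vm : ℝ))⁻¹ * m ω ^ 2 +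
      (2 * (vw : ℝ))⁻¹ * w ω ^ 2) ∂μ ≤ ∫ ω, (densityRatio vm vw d q γe γd (m ω, w ω) - 1) ∂μ := by
    refine integral_mono (j3.add i4)
      (hTi.sub (integrable_const 1)) fun ω => ?_
    have h := Real.log_le_sub_one_of_pos (densityRatio_pos hvm hvw hdz hq0 γe γd (m ω, w ω))
    rw [log_densityRatio hvm hvw hdz hq0] at h
    exact h
  rw [integral_sub hTi (integrable_const 1), hTint,
    integral_add j3 i4, integral_add j2 i3, integral_sub j1 i2, integral_sub i0 i1, integral_const_mul, integral_const_mul,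
    integral_const_mul, integral_const_mul, integral_received_sq hm.aemeasurable hw hmw he hx,
    integral_sq_of_hasLaw_gaussianReal hm, integral_sq_of_hasLaw_gaussianReal hw, ← hD, ← hP,
    ← hq] at key
  simp only [integral_const, probReal_univ, smul_eq_mul, one_mul, sub_self] at key
  have hq' : (0 : ℝ) < q := hq ▸ hQ
  have e : ∀ v : ℝ, 0 < v → (2 * v)⁻¹ * v = 1 / 2 := fun v hv => by field_simp
  rw [e _ hq', e _ hvm', e _ hvw'] at key
  -- The terms in q, vm and vw contribute -1/2, 1/2 and 1/2, and the distortion term is at least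
  -- -1/2. Together they are nonnegative, so c ≤ 0.
  have hDd : (2 * (d : ℝ))⁻¹ * D ≤ 1 / 2 := by
    rw [← e _ hd0]; exact mul_le_mul_of_nonneg_left hd.le (by positivity)
  have hlog : Real.log (vm * vw) ≤ Real.log (d * q) := by
    rw [Real.log_mul hvm'.ne' hvw'.ne', Real.log_mul hd0.ne' hq'.ne']
    linarith
  rw [← hq, div_le_iff₀ hq']
  exact (Real.log_le_log_iff (by positivity) (by positivity)).1 hlog

end

/-! ### Best responses: orthogonality and the encoder's cost -/

section

variable {Ω : Type*} [MeasurableSpace Ω] {μ : Measure Ω}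

lemma lintegral_ofReal_sq {f : Ω → ℝ} (hf : MemLp f 2 μ) :
    ∫⁻ ω, ENNReal.ofReal (f ω ^ 2) ∂μ = ENNReal.ofReal (∫ ω, f ω ^ 2 ∂μ) :=
  (ofReal_integral_eq_lintegral_ofReal hf.integrable_sq
    (Filter.Eventually.of_forall fun _ => sq_nonneg _)).symm

lemma memLp_two_of_lintegral_ofReal_sq_ne_top {f : Ω → ℝ} (hf : AEStronglyMeasurable f μ)
    (h : ∫⁻ ω, ENNReal.ofReal (f ω ^ 2) ∂μ ≠ ∞) : MemLp f 2 μ := by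
  refine (memLp_two_iff_integrable_sq hf).2 ⟨hf.pow 2, ?_⟩
  rw [hasFiniteIntegral_iff_ofReal (Filter.Eventually.of_forall fun _ => sq_nonneg _)]
  exact h.lt_top

lemma ae_eq_zero_of_integral_sq_eq_zero {f : Ω → ℝ} (hf : MemLp f 2 μ)
    (h : ∫ ω, f ω ^ 2 ∂μ = 0) : ∀ᵐ ω ∂μ, f ω = 0 := by
  filter_upwards [(integral_eq_zero_iff_of_nonneg (fun _ => sq_nonneg _) hf.integrable_sq).1 h]
    with ω hω
  exact pow_eq_zero_iff two_ne_zero |>.1 hω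

variable {m w : Ω → ℝ} {γe γd : ℝ → ℝ}

lemma aemeasurable_received (hm : AEMeasurable m μ) (hw : AEMeasurable w μ) (he : Measurable γe) :
    AEMeasurable (received m w γe) μ :=
  (he.comp_aemeasurable hm).add hw

lemma aemeasurable_action (hm : AEMeasurable m μ) (hw : AEMeasurable w μ) (he : Measurable γe)
    (hγd : Measurable γd) : AEMeasurable (action m w γe γd) μ :=
  hγd.comp_aemeasurable (aemeasurable_received hm hw he)

lemma IsBestResponse.memLp_action (hm : MemLp m 2 μ) (hw : AEMeasurable w μ) (he : Measurable γe)
    (h : IsBestResponse μ m w γe γd) : MemLp (action m w γe γd) 2 μ := by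
  have hu := aemeasurable_action hm.1.aemeasurable hw he h.measurable
  have h0 : decoderCost μ m w γe (fun _ => 0) = ENNReal.ofReal (∫ ω, m ω ^ 2 ∂μ) := by
    rw [← lintegral_ofReal_sq hm]; simp [decoderCost, action]
  -- The zero decoder has cost E[m²] < ∞, hence so does a best response.
  have hfin : decoderCost μ m w γe γd ≠ ∞ :=
    ((h.le _ measurable_const).trans_lt (h0 ▸ ENNReal.ofReal_lt_top)).ne
  have herr : MemLp (fun ω => m ω - action m w γe γd ω) 2 μ :=
    memLp_two_of_lintegral_ofReal_sq_ne_top (hm.1.sub hu.aestronglyMeasurable) hfin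
  refine (hm.sub herr).ae_eq (Filter.Eventually.of_forall fun ω => ?_)
  simp

/-- Orthogonality principle: the error of a best response is orthogonal to every square integrable
function of the channel output. -/
lemma IsBestResponse.integral_error_mul (hm : MemLp m 2 μ) (hw : AEMeasurable w μ)
    (he : Measurable γe) (h : IsBestResponse μ m w γe γd) {η : ℝ → ℝ} (hη : Measurable η)
    (hv : MemLp (action m w γe η) 2 μ) :
    ∫ ω, (m ω - action m w γe γd ω) * action m w γe η ω ∂μ = 0 := by
  have hr : MemLp (fun ω => m ω - action m w γe γd ω) 2 μ := hm.sub (h.memLp_action hm hw he)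
  set B := ∫ ω, (m ω - action m w γe γd ω) * action m w γe η ω ∂μ with hB
  set C := ∫ ω, action m w γe η ω ^ 2 ∂μ with hC
  have hC0 : 0 ≤ C := integral_nonneg fun _ => sq_nonneg _
  -- Perturbing the decoder to γd + tη changes the cost by t²C - 2tB, which cannot be negative.
  have hquad : ∀ t : ℝ, 0 ≤ t ^ 2 * C - 2 * t * B := by
    intro t
    have hle := h.le (fun y => γd y + t * η y) (h.measurable.add (hη.const_mul t))
    have e : ∀ ω, m ω - action m w γe (fun y => γd y + t * η y) ω =
        (m ω - action m w γe γd ω) - t * action m w γe η ω := by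
      intro ω; simp only [action]; ring
    have hr' : MemLp (fun ω => (m ω - action m w γe γd ω) - t * action m w γe η ω) 2 μ :=
      hr.sub (hv.const_mul t)
    have irv : Integrable (fun ω => 2 * t * ((m ω - action m w γe γd ω) * action m w γe η ω)) μ :=
      (hr.integrable_mul hv).const_mul (2 * t)
    have ivv := hv.integrable_sq.const_mul (t ^ 2)
    have i : Integrable (fun ω => (m ω - action m w γe γd ω) ^ 2 -
      2 * t * ((m ω - action m w γe γd ω) * action m w γe η ω)) μ := hr.integrable_sq.sub irv
    have e2 : ∀ ω, ((m ω - action m w γe γd ω) - t * action m w γe η ω) ^ 2 =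
        (m ω - action m w γe γd ω) ^ 2 -
          2 * t * ((m ω - action m w γe γd ω) * action m w γe η ω) +
          t ^ 2 * action m w γe η ω ^ 2 := by
      intro ω; ring
    simp only [decoderCost, e] at hle
    rw [lintegral_ofReal_sq hr, lintegral_ofReal_sq hr', ENNReal.ofReal_le_ofReal_iff
      (integral_nonneg fun _ => sq_nonneg _)] at hle
    simp_rw [e2] at hle
    rw [integral_add i ivv, integral_sub hr.integrable_sq irv, integral_const_mul,
      integral_const_mul, ← hB, ← hC] at hle
    linarith
  -- C + 1 in place of the minimizing denominator C keeps the choice of t valid when C = 0.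
  have h1 := hquad (B / (C + 1))
  have h2 : (B / (C + 1)) ^ 2 * C - 2 * (B / (C + 1)) * B = -(B ^ 2 * ((C + 2) / (C + 1) ^ 2)) := by
    field_simp; ring
  rw [h2] at h1
  have h3 : 0 < (C + 2) / (C + 1) ^ 2 := by positivity
  have h4 : B ^ 2 ≤ 0 := by
    by_contra! h5
    have := mul_pos h5 h3
    linarith
  exact pow_eq_zero_iff two_ne_zero |>.1 (le_antisymm h4 (sq_nonneg B))

lemma IsBestResponse.integral_mul_action (hm : MemLp m 2 μ) (hw : AEMeasurable w μ)
    (he : Measurable γe) (h : IsBestResponse μ m w γe γd) :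
    ∫ ω, m ω * action m w γe γd ω ∂μ = ∫ ω, action m w γe γd ω ^ 2 ∂μ := by
  have hu := h.memLp_action hm hw he
  have h0 := h.integral_error_mul hm hw he h.measurable hu
  simp_rw [sub_mul, ← sq] at h0
  rw [integral_sub (f := fun ω => m ω * action m w γe γd ω) (hm.integrable_mul hu)
    hu.integrable_sq] at h0
  linarith

lemma IsBestResponse.integral_error_sq (hm : MemLp m 2 μ) (hw : AEMeasurable w μ)
    (he : Measurable γe) (h : IsBestResponse μ m w γe γd) :
    ∫ ω, (m ω - action m w γe γd ω) ^ 2 ∂μ =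
      ∫ ω, m ω ^ 2 ∂μ - ∫ ω, action m w γe γd ω ^ 2 ∂μ := by
  have hu := h.memLp_action hm hw he
  have imu : Integrable (fun ω => 2 * (m ω * action m w γe γd ω)) μ :=
    (hm.integrable_mul hu).const_mul 2
  have i : Integrable (fun ω => m ω ^ 2 - 2 * (m ω * action m w γe γd ω)) μ :=
    hm.integrable_sq.sub imu
  have e : ∀ ω, (m ω - action m w γe γd ω) ^ 2 =
      m ω ^ 2 - 2 * (m ω * action m w γe γd ω) + action m w γe γd ω ^ 2 := fun ω => by ring
  simp_rw [e]
  rw [integral_add i hu.integrable_sq, integral_sub hm.integrable_sq imu, integral_const_mul,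
    h.integral_mul_action hm hw he]
  ring

variable [IsProbabilityMeasure μ]

lemma IsBestResponse.integral_action (hm : MemLp m 2 μ) (hw : AEMeasurable w μ)
    (he : Measurable γe) (h : IsBestResponse μ m w γe γd) :
    ∫ ω, action m w γe γd ω ∂μ = ∫ ω, m ω ∂μ := by
  have hu := h.memLp_action hm hw he
  have h0 : ∫ ω, (m ω - action m w γe γd ω) ∂μ = 0 := by
    -- Orthogonality is tested against the constant function 1.
    simpa only [action, mul_one] using
      h.integral_error_mul hm hw he (measurable_const (a := (1 : ℝ))) (memLp_const (1 : ℝ))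
  rw [integral_sub (hm.integrable (by norm_num)) (hu.integrable (by norm_num))] at h0
  exact (sub_eq_zero.1 h0).symm

/-- The encoder's cost against a best response, as a function of `E[u²]` and `E[x²]`. -/
lemma IsBestResponse.encoderCost_eq {a b ρ : ℝ} (hρ : 0 ≤ ρ) (hm : MemLp m 2 μ)
    (hm0 : ∫ ω, m ω ∂μ = 0) (hw : AEMeasurable w μ) (he : Measurable γe)
    (hx : MemLp (fun ω => γe (m ω)) 2 μ) (h : IsBestResponse μ m w γe γd) :
    0 ≤ a ^ 2 * ∫ ω, m ω ^ 2 ∂μ + b ^ 2 + ((1 - 2 * a) * ∫ ω, action m w γe γd ω ^ 2 ∂μ +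
        ρ * ∫ ω, γe (m ω) ^ 2 ∂μ) ∧
    encoderCost μ m w a b ρ γe γd = ENNReal.ofReal (a ^ 2 * ∫ ω, m ω ^ 2 ∂μ + b ^ 2 +
      ((1 - 2 * a) * ∫ ω, action m w γe γd ω ^ 2 ∂μ + ρ * ∫ ω, γe (m ω) ^ 2 ∂μ)) := by
  have hu := h.memLp_action hm hw he
  have hnn : ∀ ω, 0 ≤ (a * m ω - b - action m w γe γd ω) ^ 2 + ρ * γe (m ω) ^ 2 := fun ω => by
    positivity
  have i1 : Integrable (fun ω => (m ω * action m w γe γd ω)) μ := hm.integrable_mul hu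
  have i2 := hm.integrable (q := 2) (by norm_num)
  have i3 := hu.integrable (q := 2) (by norm_num)
  have e : ∀ ω, (a * m ω - b - action m w γe γd ω) ^ 2 + ρ * γe (m ω) ^ 2 =
      a ^ 2 * m ω ^ 2 + action m w γe γd ω ^ 2 + b ^ 2 - 2 * a * (m ω * action m w γe γd ω) -
        2 * a * b * m ω + 2 * b * action m w γe γd ω + ρ * γe (m ω) ^ 2 := fun ω => by ring
  have j1 : Integrable (fun ω => a ^ 2 * m ω ^ 2 + action m w γe γd ω ^ 2) μ :=
    (hm.integrable_sq.const_mul _).add hu.integrable_sq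
  have j2 : Integrable (fun ω => a ^ 2 * m ω ^ 2 + action m w γe γd ω ^ 2 + b ^ 2) μ :=
    j1.add (integrable_const _)
  have j3 : Integrable (fun ω => a ^ 2 * m ω ^ 2 + action m w γe γd ω ^ 2 + b ^ 2 -
      2 * a * (m ω * action m w γe γd ω)) μ := j2.sub (i1.const_mul _)
  have j4 : Integrable (fun ω => a ^ 2 * m ω ^ 2 + action m w γe γd ω ^ 2 + b ^ 2 -
      2 * a * (m ω * action m w γe γd ω) - 2 * a * b * m ω) μ := j3.sub (i2.const_mul _)
  have j5 : Integrable (fun ω => a ^ 2 * m ω ^ 2 + action m w γe γd ω ^ 2 + b ^ 2 -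
      2 * a * (m ω * action m w γe γd ω) - 2 * a * b * m ω + 2 * b * action m w γe γd ω) μ :=
    j4.add (i3.const_mul _)
  have j6 : Integrable (fun ω => (a * m ω - b - action m w γe γd ω) ^ 2 + ρ * γe (m ω) ^ 2) μ := by
    simp_rw [e]; exact j5.add (hx.integrable_sq.const_mul _)
  have hint : ∫ ω, ((a * m ω - b - action m w γe γd ω) ^ 2 + ρ * γe (m ω) ^ 2) ∂μ =
      a ^ 2 * ∫ ω, m ω ^ 2 ∂μ + b ^ 2 +
        ((1 - 2 * a) * ∫ ω, action m w γe γd ω ^ 2 ∂μ + ρ * ∫ ω, γe (m ω) ^ 2 ∂μ) := by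
    simp_rw [e]
    rw [integral_add j5 (hx.integrable_sq.const_mul _), integral_add j4 (i3.const_mul _),
      integral_sub j3 (i2.const_mul _), integral_sub j2 (i1.const_mul _),
      integral_add j1 (integrable_const _), integral_add (hm.integrable_sq.const_mul _)
      hu.integrable_sq, integral_const_mul, integral_const_mul, integral_const_mul,
      integral_const_mul, integral_const_mul, h.integral_mul_action hm hw he,
      h.integral_action hm hw he, hm0]
    simp only [integral_const, probReal_univ, smul_eq_mul]
    ring
  rw [← hint]
  exact ⟨integral_nonneg hnn,
    (ofReal_integral_eq_lintegral_ofReal j6 (Filter.Eventually.of_forall hnn)).symm⟩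

omit [IsProbabilityMeasure μ] in
-- Since ρ > 0, the power term alone would make the cost infinite. Policies of infinite power
-- therefore never compete.
lemma memLp_message_of_encoderCost_ne_top {a b ρ : ℝ} (hρ : 0 < ρ) (hm : AEMeasurable m μ)
    (he : Measurable γe) (h : encoderCost μ m w a b ρ γe γd ≠ ∞) :
    MemLp (fun ω => γe (m ω)) 2 μ := by
  refine memLp_two_of_lintegral_ofReal_sq_ne_top
    (he.comp_aemeasurable hm).aestronglyMeasurable fun htop => h (top_le_iff.1 ?_)
  calc ∞ = ENNReal.ofReal ρ * ∫⁻ ω, ENNReal.ofReal (γe (m ω) ^ 2) ∂μ := by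
        rw [htop, ENNReal.mul_top (by simpa using hρ)]
    _ = ∫⁻ ω, ENNReal.ofReal (ρ * γe (m ω) ^ 2) ∂μ := by
        rw [← lintegral_const_mul' _ _ ENNReal.ofReal_ne_top]
        simp_rw [ENNReal.ofReal_mul hρ.le]
    _ ≤ encoderCost μ m w a b ρ γe γd :=
        lintegral_mono fun ω => ENNReal.ofReal_le_ofReal (le_add_of_nonneg_left (sq_nonneg _))

end

/-! ### The optimization over the power -/

/-- `P₀` is the unique power minimizing `(1 - 2a) U + ρ P` over all `U = E[u²]` and `P = E[x²]`
compatible with the bound `U ≤ vm P / (P + vw)`, where `U` attains this bound at `P₀`. -/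
def IsOptimalPower (a ρ vm vw P₀ : ℝ) : Prop :=
  ∀ U P : ℝ, 0 ≤ U → 0 ≤ P → U * (P + vw) ≤ vm * P →
    (1 - 2 * a) * (vm * P₀ / (P₀ + vw)) + ρ * P₀ ≤ (1 - 2 * a) * U + ρ * P ∧
    ((1 - 2 * a) * U + ρ * P ≤ (1 - 2 * a) * (vm * P₀ / (P₀ + vw)) + ρ * P₀ → P = P₀)

lemma isOptimalPower_zero_of_le_half {a ρ vm vw : ℝ} (hρ : 0 < ρ) (ha : a ≤ 1 / 2) :
    IsOptimalPower a ρ vm vw 0 := by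
  intro U P hU hP _
  have h1 : 0 ≤ (1 - 2 * a) * U := mul_nonneg (by linarith) hU
  have h2 : 0 ≤ ρ * P := by positivity
  simp only [mul_zero, zero_div, add_zero]
  refine ⟨by linarith, fun h => ?_⟩
  have h3 : ρ * P = 0 := by linarith
  exact (mul_eq_zero.1 h3).resolve_left hρ.ne'

lemma isOptimalPower_zero_of_le {a ρ vm vw : ℝ} (hvw : 0 < vw) (ha : 1 / 2 < a)
    (hρ : 0 < ρ) (h : vm / vw * (2 * a - 1) ≤ ρ) : IsOptimalPower a ρ vm vw 0 := by
  intro U P hU hP hUP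
  have hQ : 0 < P + vw := by linarith
  have h' : vm * (2 * a - 1) ≤ ρ * vw := by
    rwa [div_mul_eq_mul_div, div_le_iff₀ hvw] at h
  -- Multiplying by P + vw clears the denominator of the bound on U; the threshold cancels the terms
  -- linear in P, leaving ρP².
  have key : ρ * P ^ 2 ≤ ((1 - 2 * a) * U + ρ * P) * (P + vw) := by
    have h1 := mul_le_mul_of_nonneg_left hUP (by linarith : 0 ≤ 2 * a - 1)
    have h2 := mul_le_mul_of_nonneg_right h' hP
    linarith
  simp only [mul_zero, zero_div, add_zero]
  refine ⟨?_, fun h0 => ?_⟩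
  · by_contra! hneg
    have h1 := mul_neg_of_neg_of_pos hneg hQ
    have h2 : 0 ≤ ρ * P ^ 2 := by positivity
    linarith
  · have h1 := mul_nonpos_of_nonpos_of_nonneg h0 hQ.le
    have h2 : ρ * P ^ 2 = 0 := le_antisymm (key.trans h1) (by positivity)
    exact pow_eq_zero_iff two_ne_zero |>.1 ((mul_eq_zero.1 h2).resolve_left hρ.ne')

lemma optimalPower_pos {a ρ σm σw : ℝ} (hσw : 0 < σw) (hρ : 0 < ρ)
    (h : ρ < σm ^ 2 / σw ^ 2 * (2 * a - 1)) : 0 < optimalPower a ρ σm σw := by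
  rw [div_mul_eq_mul_div, lt_div_iff₀ (by positivity)] at h
  have h1 : σw < √((2 * a - 1) * σm ^ 2 / ρ) := by
    refine Real.lt_sqrt_of_sq_lt ?_
    rw [lt_div_iff₀ hρ]; linarith
  have h2 := mul_lt_mul_of_pos_left h1 hσw
  rw [optimalPower]; linarith

lemma isOptimalPower_optimalPower {a ρ σm σw : ℝ} (hσm : 0 < σm) (hσw : 0 < σw) (ha : 1 / 2 < a)
    (hρ : 0 < ρ) : IsOptimalPower a ρ (σm ^ 2) (σw ^ 2) (optimalPower a ρ σm σw) := by
  have hc : 0 < 2 * a - 1 := by linarith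
  -- Q is the optimal value of P + σw², characterized by `hQ2`.
  obtain ⟨Q, hQ⟩ : ∃ Q, Q = σw * √((2 * a - 1) * σm ^ 2 / ρ) := ⟨_, rfl⟩
  have hQ0 : 0 < Q := by rw [hQ]; positivity
  have hQ2 : ρ * Q ^ 2 = (2 * a - 1) * σm ^ 2 * σw ^ 2 := by
    rw [hQ, mul_pow, Real.sq_sqrt (by positivity)]; field_simp
  have hP₀ : optimalPower a ρ σm σw = Q - σw ^ 2 := by rw [optimalPower, hQ]
  intro U P hU hP hUP
  have hS : 0 < P + σw ^ 2 := by positivity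
  have hmin : (1 - 2 * a) * (σm ^ 2 * (Q - σw ^ 2) / (Q - σw ^ 2 + σw ^ 2)) + ρ * (Q - σw ^ 2) =
      2 * ρ * Q - ρ * σw ^ 2 - (2 * a - 1) * σm ^ 2 := by
    rw [sub_add_cancel]
    field_simp
    linear_combination -hQ2
  rw [hP₀, hmin]
  -- Completing the square: the excess cost times P + σw² dominates ρ(P + σw² - Q)², which gives
  -- both minimality and uniqueness.
  have key : ρ * (P + σw ^ 2 - Q) ^ 2 ≤ ((1 - 2 * a) * U + ρ * P -
      (2 * ρ * Q - ρ * σw ^ 2 - (2 * a - 1) * σm ^ 2)) * (P + σw ^ 2) := by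
    have h1 := mul_le_mul_of_nonneg_left hUP hc.le
    linarith
  refine ⟨?_, fun h0 => ?_⟩
  · by_contra! hneg
    have h1 := mul_neg_of_neg_of_pos (sub_neg.2 hneg) hS
    have h2 : 0 ≤ ρ * (P + σw ^ 2 - Q) ^ 2 := by positivity
    linarith
  · have h1 := mul_nonpos_of_nonpos_of_nonneg (sub_nonpos.2 h0) hS.le
    have h2 : ρ * (P + σw ^ 2 - Q) ^ 2 = 0 := le_antisymm (key.trans h1) (by positivity)
    have h3 := pow_eq_zero_iff two_ne_zero |>.1 ((mul_eq_zero.1 h2).resolve_left hρ.ne')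
    linarith

/-! ### Linear policies and the equilibria -/

section

variable {Ω : Type*} [MeasurableSpace Ω] {μ : Measure Ω} [IsProbabilityMeasure μ]
  {m w : Ω → ℝ} {vm vw : ℝ≥0} {γe γd : ℝ → ℝ} {a b ρ : ℝ}

omit [IsProbabilityMeasure μ] in
lemma integral_linear_sq (hm : HasLaw m (gaussianReal 0 vm) μ) (α : ℝ) :
    ∫ ω, (α * m ω) ^ 2 ∂μ = α ^ 2 * vm := by
  simp_rw [mul_pow]
  rw [integral_const_mul, integral_sq_of_hasLaw_gaussianReal hm]

omit [IsProbabilityMeasure μ] in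
lemma integral_linear_action_sq (hvw : vw ≠ 0) (hm : HasLaw m (gaussianReal 0 vm) μ)
    (hw : HasLaw w (gaussianReal 0 vw) μ) (hmw : IndepFun m w μ) (α : ℝ) :
    ∫ ω, action m w (fun t => α * t) (fun y => α * vm / (α ^ 2 * vm + vw) * y) ω ^ 2 ∂μ =
      vm * (α ^ 2 * vm) / (α ^ 2 * vm + vw) := by
  have hvw' : (0 : ℝ) < vw := NNReal.coe_pos.2 (pos_iff_ne_zero.2 hvw)
  simp only [action, mul_pow]
  rw [integral_const_mul, integral_received_sq hm.aemeasurable hw hmw (by fun_prop)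
    ((memLp_two_of_hasLaw_gaussianReal hm).const_mul α), integral_linear_sq hm]
  have : 0 < α ^ 2 * vm + vw := by positivity
  field_simp

omit [IsProbabilityMeasure μ] in
lemma integral_linear_error_sq (hvw : vw ≠ 0) (hm : HasLaw m (gaussianReal 0 vm) μ)
    (hw : HasLaw w (gaussianReal 0 vw) μ) (hmw : IndepFun m w μ) (α : ℝ) :
    ∫ ω, (m ω - action m w (fun t => α * t) (fun y => α * vm / (α ^ 2 * vm + vw) * y) ω) ^ 2 ∂μ =
      vm * vw / (α ^ 2 * vm + vw) := by
  have hvw' : (0 : ℝ) < vw := NNReal.coe_pos.2 (pos_iff_ne_zero.2 hvw)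
  have hQ : 0 < α ^ 2 * vm + vw := by positivity
  set k := α * vm / (α ^ 2 * vm + vw) with hk
  have hm2 := memLp_two_of_hasLaw_gaussianReal hm
  have hw2 := memLp_two_of_hasLaw_gaussianReal hw
  have e : ∀ ω, (m ω - action m w (fun t => α * t) (fun y => k * y) ω) ^ 2 =
      (1 - k * α) ^ 2 * m ω ^ 2 - 2 * k * (1 - k * α) * (m ω * w ω) + k ^ 2 * w ω ^ 2 := by
    intro ω; simp only [action, received]; ring
  have imw : Integrable (fun ω => m ω * w ω) μ := hm2.integrable_mul hw2
  have i : Integrable (fun ω => (1 - k * α) ^ 2 * m ω ^ 2 -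
      2 * k * (1 - k * α) * (m ω * w ω)) μ :=
    (hm2.integrable_sq.const_mul _).sub (imw.const_mul _)
  have h0 : ∫ ω, m ω * w ω ∂μ = 0 := integral_comp_mul_noise hm.aemeasurable hw hmw measurable_id
  simp_rw [e]
  rw [integral_add i (hw2.integrable_sq.const_mul _),
    integral_sub (hm2.integrable_sq.const_mul _) (imw.const_mul _), integral_const_mul,
    integral_const_mul, integral_const_mul, integral_sq_of_hasLaw_gaussianReal hm,
    integral_sq_of_hasLaw_gaussianReal hw, h0, hk]
  field_simp
  ring

/-- The error of the linear decoder equals the lower bound of `mul_le_distortion_mul` for this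
power, so no decoder does better; no conditional expectation is computed. -/
lemma isBestResponse_linear (hvm : vm ≠ 0) (hvw : vw ≠ 0) (hm : HasLaw m (gaussianReal 0 vm) μ)
    (hw : HasLaw w (gaussianReal 0 vw) μ) (hmw : IndepFun m w μ) (α : ℝ) :
    IsBestResponse μ m w (fun t => α * t) (fun y => α * vm / (α ^ 2 * vm + vw) * y) := by
  have hvw' : (0 : ℝ) < vw := NNReal.coe_pos.2 (pos_iff_ne_zero.2 hvw)
  have hm2 := memLp_two_of_hasLaw_gaussianReal hm
  have hw2 := memLp_two_of_hasLaw_gaussianReal hw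
  have he : Measurable fun t : ℝ => α * t := by fun_prop
  refine ⟨by fun_prop, fun γd' hγd' => ?_⟩
  rcases eq_or_ne (decoderCost μ m w (fun t => α * t) γd') ∞ with htop | hfin
  · rw [htop]; exact le_top
  have h1 : MemLp (fun ω => m ω - action m w (fun t => α * t) γd' ω) 2 μ :=
    memLp_two_of_lintegral_ofReal_sq_ne_top (hm2.1.sub (aemeasurable_action hm.aemeasurable
      hw.aemeasurable he hγd').aestronglyMeasurable) hfin
  have h2 : MemLp (fun ω => m ω - action m w (fun t => α * t)
      (fun y => α * vm / (α ^ 2 * vm + vw) * y) ω) 2 μ :=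
    hm2.sub (((hm2.const_mul α).add hw2).const_mul _)
  have hbound := mul_le_distortion_mul hvm hvw hm hw hmw he hγd' (hm2.const_mul α) h1
  rw [integral_linear_sq hm, ← div_le_iff₀ (by positivity)] at hbound
  rw [decoderCost, decoderCost, lintegral_ofReal_sq h1, lintegral_ofReal_sq h2,
    integral_linear_error_sq hvw hm hw hmw]
  exact ENNReal.ofReal_le_ofReal hbound

/-- The power needed for a best response of second moment `E[u²]`. -/
lemma IsBestResponse.action_sq_mul_le (hvm : vm ≠ 0) (hvw : vw ≠ 0)
    (hm : HasLaw m (gaussianReal 0 vm) μ) (hw : HasLaw w (gaussianReal 0 vw) μ)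
    (hmw : IndepFun m w μ) (he : Measurable γe) (hx : MemLp (fun ω => γe (m ω)) 2 μ)
    (h : IsBestResponse μ m w γe γd) :
    (∫ ω, action m w γe γd ω ^ 2 ∂μ) * (∫ ω, γe (m ω) ^ 2 ∂μ + vw) ≤
      vm * ∫ ω, γe (m ω) ^ 2 ∂μ := by
  have hm2 := memLp_two_of_hasLaw_gaussianReal hm
  have hb := mul_le_distortion_mul hvm hvw hm hw hmw he h.measurable hx
    (hm2.sub (h.memLp_action hm2 hw.aemeasurable he))
  rw [h.integral_error_sq hm2 hw.aemeasurable he, integral_sq_of_hasLaw_gaussianReal hm] at hb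
  linarith

/-- A linear pair attains the bound on U at its power. If that power is optimal, no admissible pair
(U, P), hence no other policy, costs less. -/
theorem isStackelbergEquilibrium_linear (hvm : vm ≠ 0) (hvw : vw ≠ 0) (hρ : 0 < ρ)
    (hm : HasLaw m (gaussianReal 0 vm) μ) (hw : HasLaw w (gaussianReal 0 vw) μ)
    (hmw : IndepFun m w μ) {α : ℝ} (hα : IsOptimalPower a ρ vm vw (α ^ 2 * vm)) :
    IsStackelbergEquilibrium μ m w a b ρ (fun t => α * t)
      (fun y => α * vm / (α ^ 2 * vm + vw) * y) := by
  have hm2 := memLp_two_of_hasLaw_gaussianReal hm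
  have hm0 := integral_of_hasLaw_gaussianReal hm
  have he : Measurable fun t : ℝ => α * t := by fun_prop
  have hbr := isBestResponse_linear hvm hvw hm hw hmw α
  refine ⟨he, hbr, fun γe' γd' he' hbr' => ?_⟩
  rcases eq_or_ne (encoderCost μ m w a b ρ γe' γd') ∞ with htop | hfin
  · rw [htop]; exact le_top
  have hx' := memLp_message_of_encoderCost_ne_top hρ hm.aemeasurable he' hfin
  rw [(hbr.encoderCost_eq hρ.le hm2 hm0 hw.aemeasurable he (hm2.const_mul α)).2,
    (hbr'.encoderCost_eq hρ.le hm2 hm0 hw.aemeasurable he' hx').2,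
    integral_linear_action_sq hvw hm hw hmw, integral_linear_sq hm]
  have h := (hα _ _ (integral_nonneg fun _ => sq_nonneg _) (integral_nonneg fun _ => sq_nonneg _)
    (hbr'.action_sq_mul_le hvm hvw hm hw hmw he' hx')).1
  exact ENNReal.ofReal_le_ofReal (by linarith)

theorem IsStackelbergEquilibrium.integral_message_sq (hvm : vm ≠ 0) (hvw : vw ≠ 0) (hρ : 0 < ρ)
    (hm : HasLaw m (gaussianReal 0 vm) μ) (hw : HasLaw w (gaussianReal 0 vw) μ)
    (hmw : IndepFun m w μ) {P₀ : ℝ} (hP₀ : 0 ≤ P₀) (hopt : IsOptimalPower a ρ vm vw P₀)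
    (h : IsStackelbergEquilibrium μ m w a b ρ γe γd) :
    MemLp (fun ω => γe (m ω)) 2 μ ∧ ∫ ω, γe (m ω) ^ 2 ∂μ = P₀ := by
  have hvm' : (0 : ℝ) < vm := NNReal.coe_pos.2 (pos_iff_ne_zero.2 hvm)
  have hm2 := memLp_two_of_hasLaw_gaussianReal hm
  have hm0 := integral_of_hasLaw_gaussianReal hm
  -- The equilibrium is compared with the linear pair of power P₀: it costs no more, so the
  -- uniqueness half of `IsOptimalPower` fixes its power.
  obtain ⟨α, hα⟩ : ∃ α : ℝ, α ^ 2 * vm = P₀ := by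
    refine ⟨√(P₀ / vm), ?_⟩
    rw [Real.sq_sqrt (by positivity), div_mul_cancel₀ _ hvm'.ne']
  have he : Measurable fun t : ℝ => α * t := by fun_prop
  have hbr := isBestResponse_linear hvm hvw hm hw hmw α
  have hle := h.le _ _ he hbr
  obtain ⟨hnn, hcost⟩ := hbr.encoderCost_eq (a := a) (b := b) hρ.le hm2 hm0 hw.aemeasurable he
    (hm2.const_mul α)
  have hx : MemLp (fun ω => γe (m ω)) 2 μ :=
    memLp_message_of_encoderCost_ne_top hρ hm.aemeasurable h.measurable
      (hle.trans_lt (hcost ▸ ENNReal.ofReal_lt_top)).ne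
  refine ⟨hx, ?_⟩
  rw [hcost, (h.bestResponse.encoderCost_eq hρ.le hm2 hm0 hw.aemeasurable h.measurable hx).2,
    ENNReal.ofReal_le_ofReal_iff hnn, integral_linear_action_sq hvw hm hw hmw,
    integral_linear_sq hm, hα] at hle
  exact (hopt _ _ (integral_nonneg fun _ => sq_nonneg _) (integral_nonneg fun _ => sq_nonneg _)
    (h.bestResponse.action_sq_mul_le hvm hvw hm hw hmw h.measurable hx)).2 (by linarith)

theorem uniqueEquilibriumIsNonInformative_of_isOptimalPower_zero (hvm : vm ≠ 0) (hvw : vw ≠ 0)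
    (hρ : 0 < ρ) (hm : HasLaw m (gaussianReal 0 vm) μ) (hw : HasLaw w (gaussianReal 0 vw) μ)
    (hmw : IndepFun m w μ) (hopt : IsOptimalPower a ρ vm vw 0) :
    UniqueEquilibriumIsNonInformative μ m w a b ρ := by
  have hvw' : (0 : ℝ) < vw := NNReal.coe_pos.2 (pos_iff_ne_zero.2 hvw)
  have hm2 := memLp_two_of_hasLaw_gaussianReal hm
  have hzero : ∀ γe γd : ℝ → ℝ, IsStackelbergEquilibrium μ m w a b ρ γe γd →
      (∀ᵐ ω ∂μ, γe (m ω) = 0) ∧ ∀ᵐ ω ∂μ, action m w γe γd ω = 0 := by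
    intro γe γd h
    obtain ⟨hx, hP⟩ := h.integral_message_sq hvm hvw hρ hm hw hmw le_rfl hopt
    -- At power 0 the bound on U reads U · vw ≤ 0, so the action vanishes almost surely as well.
    have hle := h.bestResponse.action_sq_mul_le hvm hvw hm hw hmw h.measurable hx
    rw [hP, mul_zero, zero_add] at hle
    have hU : ∫ ω, action m w γe γd ω ^ 2 ∂μ = 0 :=
      le_antisymm (nonpos_of_mul_nonpos_left hle hvw') (integral_nonneg fun _ => sq_nonneg _)
    exact ⟨ae_eq_zero_of_integral_sq_eq_zero hx hP, ae_eq_zero_of_integral_sq_eq_zero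
      (h.bestResponse.memLp_action hm2 hw.aemeasurable h.measurable) hU⟩
  refine ⟨⟨⟨_, _, isStackelbergEquilibrium_linear (α := 0) hvm hvw hρ hm hw hmw (by simpa)⟩,
    fun γe γd γe' γd' h h' => ?_⟩, fun γe γd h => ?_⟩
  · obtain ⟨hx, hu⟩ := hzero _ _ h
    obtain ⟨hx', hu'⟩ := hzero _ _ h'
    refine ⟨?_, ?_⟩
    · filter_upwards [hx, hx'] with ω h1 h2
      rw [h1, h2]
    · filter_upwards [hu, hu'] with ω h1 h2
      rw [h1, h2]
  · obtain ⟨hx, hu⟩ := hzero _ _ h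
    refine ⟨?_, not_not.2 ?_, ?_⟩
    · rw [IsNonInformative, integral_of_hasLaw_gaussianReal hm]
      exact hu
    · exact (indepFun_const_right m (0 : ℝ)).congr .rfl (hx.mono fun ω h => h.symm)
    · rw [power, lintegral_congr_ae (g := fun _ => 0) (hx.mono fun ω h => by simp [h])]
      simp

omit [IsProbabilityMeasure μ] in
-- Independence would force E[m · αm] = E[m]E[αm] = 0, whereas this moment is α · vm.
lemma isInformative_linear (hvm : vm ≠ 0) (hm : HasLaw m (gaussianReal 0 vm) μ) {α : ℝ}
    (hα : α ≠ 0) : IsInformative μ m (fun t => α * t) := by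
  intro hi
  have hm2 := memLp_two_of_hasLaw_gaussianReal hm
  have h := hi.integral_fun_mul_eq_mul_integral hm2.1 (hm2.const_mul α).1
  have e : ∀ ω, m ω * (α * m ω) = α * m ω ^ 2 := fun ω => by ring
  simp_rw [e] at h
  rw [integral_of_hasLaw_gaussianReal hm, zero_mul, integral_const_mul,
    integral_sq_of_hasLaw_gaussianReal hm] at h
  exact (mul_ne_zero hα (NNReal.coe_ne_zero.2 hvm)) h

end

end GaussianSignaling

/-! ### The thresholds -/

theorem mainTheorem2 {Ω : Type*} [MeasurableSpace Ω] (μ : Measure Ω) [IsProbabilityMeasure μ]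
    (m w : Ω → ℝ) (a b ρ : ℝ) (σm σw : ℝ≥0) (hσm : 0 < σm) (hσw : 0 < σw) (hρ : 0 < ρ)
    (hm : HasLaw m (gaussianReal 0 (σm ^ 2)) μ) (hw : HasLaw w (gaussianReal 0 (σw ^ 2)) μ)
    (hmw : IndepFun m w μ) :
    (a ≤ 1 / 2 → GaussianSignaling.UniqueEquilibriumIsNonInformative μ m w a b ρ) ∧
    (1 / 2 < a →
      ((∃ γe γd : ℝ → ℝ, GaussianSignaling.IsStackelbergEquilibrium μ m w a b ρ γe γd ∧
          GaussianSignaling.IsInformative μ m γe) ↔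
        ρ < (σm : ℝ) ^ 2 / (σw : ℝ) ^ 2 * (2 * a - 1)) ∧
      (ρ < (σm : ℝ) ^ 2 / (σw : ℝ) ^ 2 * (2 * a - 1) →
        0 < GaussianSignaling.optimalPower a ρ σm σw ∧
        (∀ γe γd : ℝ → ℝ, GaussianSignaling.IsStackelbergEquilibrium μ m w a b ρ γe γd →
          GaussianSignaling.power μ m γe =
            ENNReal.ofReal (GaussianSignaling.optimalPower a ρ σm σw)) ∧
        (∀ α : ℝ, α ^ 2 = GaussianSignaling.optimalPower a ρ σm σw / (σm : ℝ) ^ 2 →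
          ∃ γd : ℝ → ℝ,
            GaussianSignaling.IsStackelbergEquilibrium μ m w a b ρ (fun t => α * t) γd ∧
            GaussianSignaling.IsInformative μ m (fun t => α * t))) ∧
      ((σm : ℝ) ^ 2 / (σw : ℝ) ^ 2 * (2 * a - 1) ≤ ρ →
        GaussianSignaling.UniqueEquilibriumIsNonInformative μ m w a b ρ)) := by
  have hσm' : (0 : ℝ) < σm := NNReal.coe_pos.2 hσm
  have hσw' : (0 : ℝ) < σw := NNReal.coe_pos.2 hσw
  have hvm : σm ^ 2 ≠ 0 := pow_ne_zero 2 hσm.ne'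
  have hvw : σw ^ 2 ≠ 0 := pow_ne_zero 2 hσw.ne'
  have hnull : GaussianSignaling.IsOptimalPower a ρ (σm ^ 2 : ℝ≥0) (σw ^ 2 : ℝ≥0) 0 →
      GaussianSignaling.UniqueEquilibriumIsNonInformative μ m w a b ρ :=
    GaussianSignaling.uniqueEquilibriumIsNonInformative_of_isOptimalPower_zero hvm hvw hρ hm hw hmw
  refine ⟨fun ha => hnull (GaussianSignaling.isOptimalPower_zero_of_le_half hρ ha), fun ha => ?_⟩
  have hhigh : (σm : ℝ) ^ 2 / (σw : ℝ) ^ 2 * (2 * a - 1) ≤ ρ →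
      GaussianSignaling.UniqueEquilibriumIsNonInformative μ m w a b ρ := fun h =>
    hnull (GaussianSignaling.isOptimalPower_zero_of_le (NNReal.coe_pos.2 (pow_pos hσw 2)) ha hρ
      (by simpa only [NNReal.coe_pow] using h))
  have hopt : GaussianSignaling.IsOptimalPower a ρ (σm ^ 2 : ℝ≥0) (σw ^ 2 : ℝ≥0)
      (GaussianSignaling.optimalPower a ρ σm σw) := by
    simpa only [NNReal.coe_pow] using
      GaussianSignaling.isOptimalPower_optimalPower hσm' hσw' ha hρ
  have hlin : ρ < (σm : ℝ) ^ 2 / (σw : ℝ) ^ 2 * (2 * a - 1) → ∀ α : ℝ,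
      α ^ 2 = GaussianSignaling.optimalPower a ρ σm σw / (σm : ℝ) ^ 2 → ∃ γd : ℝ → ℝ,
        GaussianSignaling.IsStackelbergEquilibrium μ m w a b ρ (fun t => α * t) γd ∧
        GaussianSignaling.IsInformative μ m (fun t => α * t) := by
    intro h α hα
    have hP := GaussianSignaling.optimalPower_pos hσw' hρ h
    have hα0 : α ≠ 0 := by
      rintro rfl
      have : 0 < GaussianSignaling.optimalPower a ρ σm σw / (σm : ℝ) ^ 2 := by positivity
      rw [← hα] at this
      simp at this
    have hαP : α ^ 2 * (σm ^ 2 : ℝ≥0) = GaussianSignaling.optimalPower a ρ σm σw := by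
      rw [NNReal.coe_pow, hα, div_mul_cancel₀ _ (by positivity)]
    exact ⟨_, GaussianSignaling.isStackelbergEquilibrium_linear hvm hvw hρ hm hw hmw
      (hαP.symm ▸ hopt), GaussianSignaling.isInformative_linear hvm hm hα0⟩
  refine ⟨⟨?_, fun h => ?_⟩, fun h => ?_, hhigh⟩
  · rintro ⟨γe, γd, hSE, hinf⟩
    by_contra! h
    exact ((hhigh h).2 γe γd hSE).2.1 hinf
  · have hP := GaussianSignaling.optimalPower_pos hσw' hρ h
    -- The slope is α = √(P*/σm²), read off from `Real.sq_sqrt`.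
    obtain ⟨γd, hSE, hinf⟩ := hlin h _ (Real.sq_sqrt
      (div_nonneg hP.le (sq_nonneg (σm : ℝ))))
    exact ⟨_, γd, hSE, hinf⟩
  · have hP := GaussianSignaling.optimalPower_pos hσw' hρ h
    refine ⟨hP, fun γe γd hSE => ?_, hlin h⟩
    obtain ⟨hx, hx2⟩ := hSE.integral_message_sq hvm hvw hρ hm hw hmw hP.le hopt
    rw [GaussianSignaling.power, GaussianSignaling.lintegral_ofReal_sq hx, hx2]
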